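/- Let $X$ be a nonempty compact convex subset of a (real) Hausdorff locally convex topological vector space $E$, and let $\mathcal{C}\subseteq X\times X$. Assume that a) for each $y\in X$, the lower section $\mathcal{C}^-(y)=\{x\in X:(x,y)\in\mathcal{C}\}$ is open in $X$ (for the subspace topology); b) for each $x\in X$, the upper section $\mathcal{C}^+(x)=\{y\in X:(x,y)\in\mathcal{C}\}$ is nonempty and convex. Then there exists $x^*\in X$ such that $(x^*,x^*)\in\mathcal{C}$. -/

import Mathlib

/-- The lower section `{x ∈ X : (x, y) ∈ C}` of a relation `C` at `y`. -/
def lowerSection {E : Type*} (X : Set E) (C : Set (E × E)) (y : E) : Set E :=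
  {x | x ∈ X ∧ (x, y) ∈ C}

/-- The upper section `{y ∈ X : (x, y) ∈ C}` of a relation `C` at `x`. -/
def upperSection {E : Type*} (X : Set E) (C : Set (E × E)) (x : E) : Set E :=
  {y | y ∈ X ∧ (x, y) ∈ C}

/-- `S`, as a subset of `X`, is open in the subspace topology of `X`. -/
def IsOpenIn {E : Type*} [TopologicalSpace E] (X S : Set E) : Prop :=
  IsOpen ((fun x : X => (x : E)) ⁻¹' S)

/-! By compactness finitely many lower sections cover `X`. A subordinate partition of unity `g`
turns a point of `X` into weights on the chosen `y`'s, and weights give back a point `∑ t y • y` of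
`X`. Brouwer's theorem on the simplex of weights yields a fixed `t`; with `x = ∑ t y • y`, a weight
`t y = g y x` is nonzero only if `(x, y) ∈ C`. Thus `x` is a convex combination of points of its own
convex upper section. Brouwer is derived from Scarf's lemma (`exists_isDominant_colorful`), a parity
count that replaces Sperner's lemma and needs no triangulation. -/

/-! ### Scarf's combinatorial lemma -/

section Scarf

variable {S I α : Type*} [LinearOrder α]

/-- A finite set `B` is dominant for the family of orders on `S` induced by `u` if no point of `S`
lies strictly above the minimum of `B` in every one of these orders. -/
def IsDominant (u : I → S → α) (B : Finset S) : Prop :=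
  ∀ y, ∃ i, ∀ x ∈ B, u i y ≤ u i x

theorem IsDominant.subset {u : I → S → α} {A B : Finset S} (hB : IsDominant u B) (h : A ⊆ B) :
    IsDominant u A := fun y => (hB y).imp fun _ hi x hx => hi x (h hx)

/-- In a dominant set with as many points as there are orders, every point is minimal for at most
one order. -/
theorem IsDominant.index_unique [Fintype I] {u : I → S → α} (hu : ∀ i, Function.Injective (u i))
    {B : Finset S} (hB : IsDominant u B) (hcard : B.card = Fintype.card I) {x : S} (hx : x ∈ B)
    {i j : I} (hi : ∀ z ∈ B, u i x ≤ u i z) (hj : ∀ z ∈ B, u j x ≤ u j z) : i = j := by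
  -- Dominance tested at a point of `B` itself gives an order in which that point is minimal; by
  -- cardinality this assignment is a bijection.
  choose f hf using fun y : B => hB y
  have hinj : Function.Injective f := by
    intro a b hab
    refine Subtype.ext (hu (f a) (le_antisymm (hf a b b.2) ?_))
    rw [hab]
    exact hf b a a.2
  have hbij : Function.Bijective f :=
    (Fintype.bijective_iff_injective_and_card f).2 ⟨hinj, by simpa using hcard⟩
  have key : ∀ k, (∀ z ∈ B, u k x ≤ u k z) → k = f ⟨x, hx⟩ := by
    intro k hk
    obtain ⟨a, rfl⟩ := hbij.2 k
    congr 1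
    exact Subtype.ext (hu _ (le_antisymm (hf a x hx) (hk a a.2)))
  rw [key i hi, key j hj]

/-- If `x` were below `y` in order `j`, dominance of `insert x d` at `y` would make `y` minimal in a
second order, against `index_unique`. -/
theorem eq_of_isDominant_insert [Fintype I] [DecidableEq S] {u : I → S → α}
    (hu : ∀ i, Function.Injective (u i)) {d : Finset S} {x y : S} {j : I}
    (hx : IsDominant u (insert x d)) (hy : IsDominant u (insert y d))
    (hxc : (insert x d).card = Fintype.card I) (hyc : (insert y d).card = Fintype.card I)
    (hxj : ∀ z ∈ d, u j x ≤ u j z) (hyj : ∀ z ∈ d, u j y ≤ u j z) : x = y := by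
  have key : ∀ x y : S, IsDominant u (insert x d) → IsDominant u (insert y d) →
      (insert y d).card = Fintype.card I → (∀ z ∈ d, u j y ≤ u j z) → ¬ u j x < u j y := by
    intro x y hx hy hyc hyj hlt
    obtain ⟨i, hi⟩ := hx y
    have : i = j := hy.index_unique hu hyc (Finset.mem_insert_self y d)
      (fun z hz => by
        rcases Finset.mem_insert.1 hz with rfl | hz
        · exact le_rfl
        · exact hi z (Finset.mem_insert_of_mem hz))
      (fun z hz => by
        rcases Finset.mem_insert.1 hz with rfl | hz
        · exact le_rfl
        · exact hyj z hz)
    subst this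
    exact absurd (hi x (Finset.mem_insert_self x d)) (not_le.2 hlt)
  exact hu j (le_antisymm (not_lt.1 (key y x hy hx hxc hxj)) (not_lt.1 (key x y hx hy hyc hyj)))

/-- If one point of a dominant set is minimal for two orders `j ≠ j'`, the set can be enlarged by a
new point which is minimal for `j`. -/
theorem IsDominant.exists_insert [Finite S] [DecidableEq S] {u : I → S → α}
    {d : Finset S} (hd : IsDominant u d) {j j' : I} (hjj : j ≠ j') {a : S}
    (hu : Function.Injective (u j))
    (haj : ∀ z ∈ d, u j a ≤ u j z) (haj' : ∀ z ∈ d, u j' a ≤ u j' z) (ha : a ∈ d)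
    (hne : ∃ y, ∀ i, i ≠ j → ∃ x ∈ d, u i x < u i y) :
    ∃ x, x ∉ d ∧ IsDominant u (insert x d) ∧ ∀ z ∈ d, u j x ≤ u j z := by
  -- Among the points that only order `j` can block, the `j`-largest is added, so `j` still blocks
  -- all of them.
  obtain ⟨x, hxY, hxmax⟩ := Set.exists_max_image {y | ∀ i, i ≠ j → ∃ x ∈ d, u i x < u i y} (u j)
    (Set.toFinite _) hne
  have hxj : ∀ z ∈ d, u j x ≤ u j z := by
    obtain ⟨i, hi⟩ := hd x
    by_cases hij : i = j
    · exact hij ▸ hi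
    · obtain ⟨z, hz, hlt⟩ := hxY i hij
      exact absurd (hi z hz) (not_le.2 hlt)
  refine ⟨x, fun hxd => ?_, fun y => ?_, hxj⟩
  · have hxa : x = a := hu (le_antisymm (hxj a ha) (haj x hxd))
    obtain ⟨z, hz, hlt⟩ := hxY j' hjj.symm
    exact absurd (hxa ▸ haj' z hz) (not_le.2 hlt)
  · by_cases hy : ∀ i, i ≠ j → ∃ x ∈ d, u i x < u i y
    · refine ⟨j, fun z hz => ?_⟩
      rcases Finset.mem_insert.1 hz with rfl | hz
      · exact hxmax y hy
      · exact (hxmax y hy).trans (hxj z hz)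
    · push Not at hy
      obtain ⟨i, hij, hi⟩ := hy
      refine ⟨i, fun z hz => ?_⟩
      rcases Finset.mem_insert.1 hz with rfl | hz
      · obtain ⟨w, hw, hlt⟩ := hxY i hij
        exact (hi w hw).trans hlt.le
      · exact hi z hz

/-- A dominant set with one point fewer than there are orders extends by one point to a dominant
set in exactly two ways, unless it is of an exceptional kind. -/
theorem IsDominant.exists_two_insert [Finite S] [DecidableEq S] [Fintype I] {u : I → S → α}
    (hu : ∀ i, Function.Injective (u i)) {d : Finset S} (hd : IsDominant u d)
    (hcard : d.card + 1 = Fintype.card I) (hdne : d.Nonempty)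
    (hne : ∀ j, ∃ y, ∀ i, i ≠ j → ∃ x ∈ d, u i x < u i y) :
    ∃ x₁ x₂, x₁ ∉ d ∧ x₂ ∉ d ∧ x₁ ≠ x₂ ∧
      ∀ x, x ∉ d → (IsDominant u (insert x d) ↔ x = x₁ ∨ x = x₂) := by
  choose m hmd hm using fun i => Finset.exists_min_image d (u i) hdne
  -- Pigeonhole: two orders share a minimizer in `d`. A new point must take over the minimum in one
  -- of them, which gives the two extensions.
  obtain ⟨j, -, j', -, hjj, hmm⟩ := Finset.exists_ne_map_eq_of_card_lt_of_maps_to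
    (s := (Finset.univ : Finset I)) (t := d) (f := m) (by rw [Finset.card_univ]; omega)
    (fun i _ => hmd i)
  have hm' : ∀ z ∈ d, u j' (m j) ≤ u j' z := hmm ▸ hm j'
  obtain ⟨x₁, hx₁, hdx₁, hx₁j⟩ := hd.exists_insert hjj (hu j) (hm j) hm' (hmd j) (hne j)
  obtain ⟨x₂, hx₂, hdx₂, hx₂j⟩ := hd.exists_insert hjj.symm (hu j') hm' (hm j) (hmd j) (hne j')
  have hc : ∀ x, x ∉ d → (insert x d).card = Fintype.card I := fun x hx => by
    rw [Finset.card_insert_of_notMem hx, hcard]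
  have hins : ∀ x i, (∀ z ∈ d, u i x ≤ u i z) → ∀ z ∈ insert x d, u i x ≤ u i z := by
    intro x i h z hz
    rcases Finset.mem_insert.1 hz with rfl | hz
    · exact le_rfl
    · exact h z hz
  refine ⟨x₁, x₂, hx₁, hx₂, ?_, fun x hx => ⟨fun hdx => ?_, ?_⟩⟩
  · rintro rfl
    exact hjj (hdx₁.index_unique hu (hc _ hx₁) (Finset.mem_insert_self _ _)
      (hins _ _ hx₁j) (hins _ _ hx₂j))
  · by_cases h1 : ∀ z ∈ d, u j x ≤ u j z
    · exact Or.inl (eq_of_isDominant_insert hu hdx hdx₁ (hc _ hx) (hc _ hx₁) h1 hx₁j)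
    by_cases h2 : ∀ z ∈ d, u j' x ≤ u j' z
    · exact Or.inr (eq_of_isDominant_insert hu hdx hdx₂ (hc _ hx) (hc _ hx₂) h2 hx₂j)
    exfalso
    push Not at h1 h2
    obtain ⟨z₁, hz₁, h1⟩ := h1
    obtain ⟨z₂, hz₂, h2⟩ := h2
    refine hjj (hdx.index_unique hu (hc _ hx) (Finset.mem_insert_of_mem (hmd j)) ?_ ?_)
    · intro z hz
      rcases Finset.mem_insert.1 hz with rfl | hz
      · exact (hm j z₁ hz₁).trans h1.le
      · exact hm j z hz
    · intro z hz
      rcases Finset.mem_insert.1 hz with rfl | hz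
      · exact (hm' z₂ hz₂).trans h2.le
      · exact hm' z hz
  · rintro (rfl | rfl)
    · exact hdx₁
    · exact hdx₂

/-- Among the subsets of `r` obtained by removing one point, the number of those whose colours are
all but `i₀` is odd exactly if `r` carries all colours. -/
theorem odd_card_almost_colorful_iff [Fintype I] [DecidableEq I] [DecidableEq S] (c : S → I)
    (i₀ : I) (r : Finset S) (hr : r.card = Fintype.card I) :
    Odd (r.filter fun x => (r.erase x).image c = Finset.univ.erase i₀).card ↔
      r.image c = Finset.univ := by
  have herase : ∀ x ∈ r, (r.erase x).image c = Finset.univ.erase i₀ →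
      Set.InjOn c (r.erase x) := by
    intro x hx h
    rw [← Finset.card_image_iff, h, Finset.card_erase_of_mem hx,
      Finset.card_erase_of_mem (Finset.mem_univ _), hr, Finset.card_univ]
  constructor
  · intro hodd
    by_contra hcol
    obtain ⟨x, hx⟩ := Finset.card_pos.1 hodd.pos
    obtain ⟨hxr, hxc⟩ := Finset.mem_filter.1 hx
    -- The removed colour is repeated exactly once in `r`, so precisely the two points sharing it
    -- can be removed.
    have hcx : c x ∈ (r.erase x).image c := by
      rw [hxc]
      refine Finset.mem_erase.2 ⟨fun h => hcol ?_, Finset.mem_univ _⟩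
      rw [← Finset.insert_erase hxr, Finset.image_insert, hxc, h,
        Finset.insert_erase (Finset.mem_univ _)]
    obtain ⟨y, hy, hyx⟩ := Finset.mem_image.1 hcx
    obtain ⟨hne, hyr⟩ := Finset.mem_erase.1 hy
    have : (r.filter fun x => (r.erase x).image c = Finset.univ.erase i₀) = {x, y} := by
      ext z
      simp only [Finset.mem_filter, Finset.mem_insert, Finset.mem_singleton]
      constructor
      · rintro ⟨hzr, hzc⟩
        by_contra! hz
        exact hne (herase z hzr hzc (by simp [hyr, hz.2.symm]) (by simp [hxr, hz.1.symm]) hyx)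
      · rintro (rfl | rfl)
        · exact ⟨hxr, hxc⟩
        · refine ⟨hyr, ?_⟩
          rw [← hxc, ← Finset.insert_erase (Finset.mem_erase.2 ⟨hne.symm, hxr⟩),
            ← Finset.insert_erase hy, Finset.image_insert, Finset.image_insert, hyx,
            Finset.erase_right_comm]
    rw [this, Finset.card_pair hne.symm] at hodd
    exact absurd hodd (by decide)
  · intro hcol
    have hinj : Set.InjOn c r := by
      rw [← Finset.card_image_iff, hcol, hr, Finset.card_univ]
    obtain ⟨x, hxr, hx⟩ := Finset.mem_image.1 (hcol ▸ Finset.mem_univ i₀ : i₀ ∈ r.image c)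
    have : (r.filter fun x => (r.erase x).image c = Finset.univ.erase i₀) = {x} := by
      ext z
      simp only [Finset.mem_filter, Finset.mem_singleton]
      constructor
      · rintro ⟨hzr, hzc⟩
        by_contra hz
        have : i₀ ∈ (r.erase z).image c :=
          Finset.mem_image.2 ⟨x, Finset.mem_erase.2 ⟨Ne.symm hz, hxr⟩, hx⟩
        simp [hzc] at this
      · rintro rfl
        refine ⟨hxr, ?_⟩
        ext i
        simp only [Finset.mem_image, Finset.mem_erase, Finset.mem_univ, and_true]
        constructor
        · rintro ⟨w, ⟨hwz, hwr⟩, rfl⟩ h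
          exact hwz (hinj hwr hxr (h.trans hx.symm))
        · intro hi
          obtain ⟨w, hwr, hw⟩ := Finset.mem_image.1 (hcol ▸ Finset.mem_univ i : i ∈ r.image c)
          exact ⟨w, ⟨fun h => hi (by rw [← hw, h, hx]), hwr⟩, hw⟩
    rw [this, Finset.card_singleton]
    exact odd_one

/-- Scarf's lemma: for points `T` together with a slack point for each order, any colouring of `T`
admits a dominant set carrying all colours, the slack points being coloured by their order. -/
theorem exists_isDominant_colorful {T : Type*} [Fintype T] [Nonempty T] [Fintype I] [Nonempty I]
    {u : I → T ⊕ I → α} (hu : ∀ i, Function.Injective (u i))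
    (hmin : ∀ i x, u i (Sum.inr i) ≤ u i x)
    (hslack : ∀ i j x, i ≠ j → u i (Sum.inl x) < u i (Sum.inr j)) (c : T → I) :
    ∃ B, IsDominant u B ∧ ∀ i, ∃ x ∈ B, Sum.elim c id x = i := by
  classical
  obtain ⟨i₀⟩ := ‹Nonempty I›
  set col : T ⊕ I → I := Sum.elim c id with hcol
  -- Pairs `d ⊆ r` are counted twice. Each `d ∈ D` lies in two members of `R`, except `o`, which
  -- lies in one; so some `r` contains an odd number of `d`'s.
  set R : Finset (Finset (T ⊕ I)) :=
    Finset.univ.filter fun r => IsDominant u r ∧ r.card = Fintype.card I with hR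
  set D : Finset (Finset (T ⊕ I)) := Finset.univ.filter fun d =>
    IsDominant u d ∧ d.card + 1 = Fintype.card I ∧ d.image col = Finset.univ.erase i₀ with hD
  set o : Finset (T ⊕ I) := (Finset.univ.erase i₀).image Sum.inr with ho
  have hcount := Finset.sum_card_bipartiteAbove_eq_sum_card_bipartiteBelow
    (s := D) (t := R) (fun d r => d ⊆ r)
  have hsup : ∀ d ∈ D, (R.bipartiteAbove (fun d r => d ⊆ r) d).card =
      (Finset.univ.filter fun x => x ∉ d ∧ IsDominant u (insert x d)).card := by
    intro d hd
    simp only [hD, Finset.mem_filter, Finset.mem_univ, true_and] at hd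
    symm
    refine Finset.card_bij (fun x _ => insert x d) ?_ ?_ ?_
    · intro x hx
      simp only [Finset.mem_filter, Finset.mem_univ, true_and] at hx
      simp only [Finset.bipartiteAbove, hR, Finset.mem_filter, Finset.mem_univ, true_and]
      exact ⟨⟨hx.2, by rw [Finset.card_insert_of_notMem hx.1, hd.2.1]⟩, Finset.subset_insert _ _⟩
    · intro x hx y hy h
      simp only [Finset.mem_filter, Finset.mem_univ, true_and] at hx
      have := Finset.mem_insert_self x d
      rw [h] at this
      exact (Finset.mem_insert.1 this).resolve_right hx.1
    · intro r hr
      simp only [Finset.bipartiteAbove, hR, Finset.mem_filter, Finset.mem_univ, true_and] at hr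
      obtain ⟨x, hx⟩ := Finset.card_eq_one.1 (show (r \ d).card = 1 by
        rw [Finset.card_sdiff_of_subset hr.2, hr.1.2, ← hd.2.1]; omega)
      have hxr : insert x d = r := by
        rw [Finset.insert_eq, ← hx, Finset.sdiff_union_of_subset hr.2]
      have hxd : x ∉ d := (Finset.mem_sdiff.1 (hx ▸ Finset.mem_singleton_self x)).2
      exact ⟨x, by simp [hxd, hxr, hr.1.1], hxr⟩
  have hsub : ∀ r ∈ R, (D.bipartiteBelow (fun d r => d ⊆ r) r).card =
      (r.filter fun x => (r.erase x).image col = Finset.univ.erase i₀).card := by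
    intro r hr
    simp only [hR, Finset.mem_filter, Finset.mem_univ, true_and] at hr
    symm
    refine Finset.card_bij (fun x _ => r.erase x) ?_ ?_ ?_
    · intro x hx
      simp only [Finset.mem_filter] at hx
      simp only [Finset.bipartiteBelow, hD, Finset.mem_filter, Finset.mem_univ, true_and]
      exact ⟨⟨hr.1.subset (Finset.erase_subset _ _),
        by rw [Finset.card_erase_add_one hx.1, hr.2], hx.2⟩, Finset.erase_subset _ _⟩
    · intro x hx y hy h
      simp only [Finset.mem_filter] at hx
      by_contra hne
      have : x ∈ r.erase y := Finset.mem_erase.2 ⟨hne, hx.1⟩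
      rw [← h] at this
      simp at this
    · intro d hd
      simp only [Finset.bipartiteBelow, hD, Finset.mem_filter, Finset.mem_univ, true_and] at hd
      obtain ⟨x, hx⟩ := Finset.card_eq_one.1 (show (r \ d).card = 1 by
        rw [Finset.card_sdiff_of_subset hd.2, hr.2, ← hd.1.2.1]; omega)
      have hxr : r.erase x = d := by
        rw [Finset.erase_eq, ← hx, Finset.sdiff_sdiff_eq_self hd.2]
      have hxr' : x ∈ r := (Finset.mem_sdiff.1 (hx ▸ Finset.mem_singleton_self x)).1
      exact ⟨x, by simp [hxr, hxr', hd.1.2.2], hxr⟩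
  rw [Finset.sum_congr rfl hsup, Finset.sum_congr rfl hsub] at hcount
  have hblock : ∀ i x, (∀ z ∈ o, u i (Sum.inl x) ≤ u i z) → i = i₀ := by
    intro i x h
    by_contra hi
    have := h (Sum.inr i) (by simp [ho, hi])
    exact absurd (hu i (le_antisymm this (hmin i _))) (by simp)
  have hdom : ∀ x, IsDominant u (insert (Sum.inl x) o) ↔
      ∀ y, u i₀ (Sum.inl y) ≤ u i₀ (Sum.inl x) := by
    intro x
    constructor
    · intro h y
      obtain ⟨i, hi⟩ := h (Sum.inl y)
      obtain rfl := hblock i y fun z hz => hi z (Finset.mem_insert_of_mem hz)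
      exact hi _ (Finset.mem_insert_self _ _)
    · rintro h (y | i)
      · refine ⟨i₀, fun z hz => ?_⟩
        rcases Finset.mem_insert.1 hz with rfl | hz
        · exact h y
        · obtain ⟨k, hk, rfl⟩ := Finset.mem_image.1 hz
          exact (hslack _ _ _ (Finset.ne_of_mem_erase hk).symm).le
      · exact ⟨i, fun z _ => hmin i z⟩
  obtain ⟨t, ht⟩ := Finite.exists_max fun y : T => u i₀ (Sum.inl y)
  have hoD : o ∈ D := by
    simp only [hD, Finset.mem_filter, Finset.mem_univ, true_and]
    refine ⟨((hdom t).2 ht).subset (Finset.subset_insert _ _), ?_, ?_⟩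
    · rw [ho, Finset.card_image_of_injective _ Sum.inr_injective,
        Finset.card_erase_add_one (Finset.mem_univ _), Finset.card_univ]
    · rw [ho, Finset.image_image]
      exact Finset.image_id
  have hodd_iff : ∀ d ∈ D,
      (Odd (Finset.univ.filter fun x => x ∉ d ∧ IsDominant u (insert x d)).card ↔ d = o) := by
    intro d hd
    constructor
    · intro hodd
      by_contra hdo
      simp only [hD, Finset.mem_filter, Finset.mem_univ, true_and] at hd
      -- Without a point of `T`, the colours of `d` would force `d = o`.
      obtain ⟨x, hx⟩ : ∃ x, Sum.inl x ∈ d := by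
        by_contra! hno
        refine hdo ?_
        ext (x | i)
        · simp [hno, ho]
        · have := congrArg (i ∈ ·) hd.2.2
          simpa [hcol, hno, ho] using this
      obtain ⟨x₁, x₂, h₁, h₂, h₁₂, h⟩ := hd.1.exists_two_insert hu hd.2.1 ⟨_, hx⟩
        fun j => ⟨Sum.inr j, fun i hij => ⟨_, hx, hslack i j x hij⟩⟩
      have : (Finset.univ.filter fun x => x ∉ d ∧ IsDominant u (insert x d)) = {x₁, x₂} := by
        ext z
        simp only [Finset.mem_filter, Finset.mem_univ, true_and, Finset.mem_insert,
          Finset.mem_singleton]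
        constructor
        · rintro ⟨hz, hz'⟩
          exact (h z hz).1 hz'
        · rintro (rfl | rfl)
          · exact ⟨h₁, (h _ h₁).2 (Or.inl rfl)⟩
          · exact ⟨h₂, (h _ h₂).2 (Or.inr rfl)⟩
      rw [this, Finset.card_pair h₁₂] at hodd
      exact absurd hodd (by decide)
    · rintro rfl
      have : (Finset.univ.filter fun x => x ∉ o ∧ IsDominant u (insert x o)) = {Sum.inl t} := by
        ext z
        simp only [Finset.mem_filter, Finset.mem_univ, true_and, Finset.mem_singleton]
        constructor
        · rintro ⟨hz, hz'⟩
          rcases z with x | i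
          · exact hu i₀ (le_antisymm (ht x) ((hdom x).1 hz' t))
          · exfalso
            obtain rfl : i = i₀ := by
              by_contra hi
              exact hz (by simp [ho, hi])
            obtain ⟨k, hk⟩ := hz' (Sum.inl t)
            obtain rfl := hblock k t fun z hz => hk z (Finset.mem_insert_of_mem hz)
            have := hk _ (Finset.mem_insert_self _ _)
            exact absurd (hu _ (le_antisymm this (hmin _ _))) (by simp)
        · rintro rfl
          exact ⟨by simp [ho], (hdom t).2 ht⟩
      rw [this, Finset.card_singleton]
      exact odd_one
  have hodd : Odd (∑ d ∈ D,
      (Finset.univ.filter fun x => x ∉ d ∧ IsDominant u (insert x d)).card) := by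
    rw [Finset.odd_sum_iff_odd_card_odd, Finset.filter_congr hodd_iff,
      Finset.filter_eq' D o, if_pos hoD, Finset.card_singleton]
    exact odd_one
  rw [hcount, Finset.odd_sum_iff_odd_card_odd] at hodd
  obtain ⟨r, hr⟩ := Finset.card_pos.1 hodd.pos
  obtain ⟨hrR, hr⟩ := Finset.mem_filter.1 hr
  simp only [hR, Finset.mem_filter, Finset.mem_univ, true_and] at hrR
  have himg := (odd_card_almost_colorful_iff col i₀ r hrR.2).1 hr
  exact ⟨r, hrR.1, fun i => Finset.mem_image.1 (himg ▸ Finset.mem_univ i)⟩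

end Scarf

/-! ### Brouwer's theorem on the simplex -/

section Brouwer

variable {ι : Type*} [Fintype ι]

/-- Scarf's lemma for a finite set `T` of points of the simplex, coloured by the vertices: some
nonempty `σ ⊆ T` has a lower bound `m` which no point of `T` strictly exceeds, and `σ` has points of
every colour `i` except possibly those with `m i = 0`. -/
theorem exists_colorful_of_finset [Nonempty ι] (T : Finset (ι → ℝ)) (hT : T.Nonempty)
    (hTΔ : (T : Set (ι → ℝ)) ⊆ stdSimplex ℝ ι) (c : (ι → ℝ) → ι) :
    ∃ (m : ι → ℝ) (σ : Finset (ι → ℝ)), σ ⊆ T ∧ σ.Nonempty ∧ (∀ i, 0 ≤ m i) ∧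
      (∀ x ∈ σ, ∀ i, m i ≤ x i) ∧ (∀ i, m i = 0 ∨ ∃ x ∈ σ, c x = i) ∧
      ∀ y ∈ T, ∃ i, y i ≤ m i := by
  classical
  have : Nonempty T := hT.to_subtype
  -- Coordinates in the simplex lie in `[0, 1]`, so -1 and 2 put slack points strictly below or
  -- above; the enumeration `e` breaks ties.
  let p : T ⊕ ι → ι → ℝ := Sum.elim (fun t => t.1) (fun j i => if i = j then -1 else 2)
  let e := Fintype.equivFin (T ⊕ ι)
  let u : ι → T ⊕ ι → ℝ ×ₗ Fin (Fintype.card (T ⊕ ι)) := fun i x => toLex (p x i, e x)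
  have hlt : ∀ i x y, p x i < p y i → u i x < u i y := fun i x y h => by
    rw [Prod.Lex.toLex_lt_toLex]
    exact Or.inl h
  have hle : ∀ i x y, u i x ≤ u i y → p x i ≤ p y i := fun i x y h =>
    not_lt.1 fun h' => absurd (hlt _ _ _ h') (not_lt.2 h)
  have hu : ∀ i, Function.Injective (u i) := fun i x y h =>
    e.injective (congrArg Prod.snd (toLex.injective h))
  have h0 : ∀ (t : T) i, 0 ≤ t.1 i := fun t i => (hTΔ t.2).1 i
  have h1 : ∀ (t : T) i, t.1 i ≤ 1 := fun t i => (mem_Icc_of_mem_stdSimplex (hTΔ t.2) i).2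
  obtain ⟨B, hB, hBc⟩ := exists_isDominant_colorful (u := u) hu
    (by
      intro i x
      by_cases hx : x = Sum.inr i
      · rw [hx]
      · refine (hlt _ _ _ ?_).le
        rcases x with t | j
        · simpa [p] using (neg_one_lt_zero.trans_le (h0 t i))
        · have : i ≠ j := fun h => hx (h ▸ rfl)
          simp only [p, Sum.elim_inr, if_true, if_neg this]
          norm_num)
    (by
      intro i j t hij
      refine hlt _ _ _ ?_
      simp only [p, Sum.elim_inr, Sum.elim_inl, if_neg hij]
      linarith [h1 t i]) (fun t => c t.1)
  let σ : Finset (ι → ℝ) := T.filter fun x => ∃ h : x ∈ T, Sum.inl ⟨x, h⟩ ∈ B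
  have hσ : ∀ t : T, Sum.inl t ∈ B → t.1 ∈ σ := fun t ht => Finset.mem_filter.2 ⟨t.2, t.2, ht⟩
  have hcol : ∀ i, Sum.inr i ∉ B → ∃ x ∈ σ, c x = i := by
    intro i hi
    obtain ⟨t | j, hx, hxi⟩ := hBc i
    · exact ⟨t, hσ t hx, hxi⟩
    · obtain rfl : j = i := hxi
      exact absurd hx hi
  have hdom : ∀ y : T, ∃ i, Sum.inr i ∉ B ∧ ∀ x ∈ σ, y.1 i ≤ x i := by
    intro y
    obtain ⟨i, hi⟩ := hB (Sum.inl y)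
    refine ⟨i, fun hiB => ?_, fun x hx => ?_⟩
    · have := hle _ _ _ (hi _ hiB)
      simp only [p, Sum.elim_inl, Sum.elim_inr, if_true] at this
      linarith [h0 y i]
    · obtain ⟨hxT, _, hxB⟩ := Finset.mem_filter.1 hx
      exact hle _ _ _ (hi _ hxB)
  have hσne : σ.Nonempty := by
    obtain ⟨t⟩ := ‹Nonempty T›
    obtain ⟨i, hi, -⟩ := hdom t
    obtain ⟨x, hx, -⟩ := hcol i hi
    exact ⟨x, hx⟩
  have hσ0 : ∀ x ∈ σ, ∀ i, 0 ≤ x i := fun x hx =>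
    (hTΔ (Finset.mem_filter.1 hx).1).1
  choose q hqσ hq using fun i => Finset.exists_min_image σ (fun x => x i) hσne
  refine ⟨fun i => if Sum.inr i ∈ B then 0 else q i i, σ, Finset.filter_subset _ _, hσne,
    fun i => ?_, fun x hx i => ?_, fun i => ?_, fun y hy => ?_⟩
  · dsimp only
    split_ifs
    · exact le_rfl
    · exact hσ0 _ (hqσ i) i
  · dsimp only
    split_ifs
    · exact hσ0 x hx i
    · exact hq i x hx
  · by_cases hi : Sum.inr i ∈ B
    · exact Or.inl (if_pos hi)
    · exact Or.inr (hcol i hi)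
  · obtain ⟨i, hi, h⟩ := hdom ⟨y, hy⟩
    refine ⟨i, ?_⟩
    dsimp only
    rw [if_neg hi]
    exact h _ (hqσ i)

/-- A colouring of the simplex by its vertices has points of all colours arbitrarily close to some
point `z`, apart from colours `i` for which `z i` is small. -/
theorem exists_near_colorful [Nonempty ι] (c : (ι → ℝ) → ι) {δ : ℝ} (hδ : 0 < δ) :
    ∃ z ∈ stdSimplex ℝ ι, ∀ i, z i ≤ δ ∨ ∃ x ∈ stdSimplex ℝ ι, c x = i ∧ dist x z ≤ δ := by
  set n : ℝ := (Fintype.card ι : ℝ) with hn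
  have hn0 : 0 < n := by
    rw [hn]
    exact_mod_cast Fintype.card_pos
  obtain ⟨T, hTΔ, hTfin, hcov⟩ :=
    (isCompact_stdSimplex ℝ ι).finite_cover_balls (e := δ / n) (by positivity)
  lift T to Finset (ι → ℝ) using hTfin
  have hT : T.Nonempty := by
    classical
    obtain ⟨i⟩ := ‹Nonempty ι›
    obtain ⟨t, ht, -⟩ := Set.mem_iUnion₂.1 (hcov (single_mem_stdSimplex ℝ i))
    exact ⟨t, ht⟩
  obtain ⟨m, σ, hσT, ⟨z, hz⟩, hm0, hmσ, hmc, hmT⟩ := exists_colorful_of_finset T hT hTΔ c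
  -- Otherwise, spreading the deficit evenly over `m` gives a point of the simplex whose nearby net
  -- point exceeds `m` in every coordinate.
  have hsum : 1 - δ ≤ ∑ i, m i := by
    by_contra! hlt
    set r : ℝ := (1 - ∑ i, m i) / n with hr
    have hrδ : δ / n < r := by
      rw [hr]
      gcongr
      linarith
    have hr0 : 0 < r := (by positivity : 0 < δ / n).trans hrδ
    have hw : (fun i => m i + r) ∈ stdSimplex ℝ ι := by
      refine ⟨fun i => by linarith [hm0 i], ?_⟩
      rw [Finset.sum_add_distrib, Finset.sum_const, Finset.card_univ, nsmul_eq_mul, ← hn, hr]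
      field_simp
      ring
    obtain ⟨y, hy, hyw⟩ := Set.mem_iUnion₂.1 (hcov hw)
    obtain ⟨i, hi⟩ := hmT y hy
    have h1 := (dist_le_pi_dist (fun i => m i + r) y i).trans_lt hyw
    rw [Real.dist_eq] at h1
    linarith [(abs_lt.1 h1).2]
  have hup : ∀ x ∈ σ, ∀ i, x i ≤ m i + δ := by
    intro x hx i
    have h1 : x i - m i ≤ ∑ j, (x j - m j) :=
      Finset.single_le_sum (f := fun j => x j - m j)
        (fun j _ => sub_nonneg.2 (hmσ x hx j)) (Finset.mem_univ i)
    rw [Finset.sum_sub_distrib, (hTΔ (hσT hx)).2] at h1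
    linarith
  refine ⟨z, hTΔ (hσT hz), fun i => ?_⟩
  rcases hmc i with h | ⟨x, hx, hxc⟩
  · left
    linarith [hup z hz i]
  · refine Or.inr ⟨x, hTΔ (hσT hx), hxc, (dist_pi_le_iff hδ.le).2 fun j => ?_⟩
    rw [Real.dist_eq, abs_le]
    constructor <;> linarith [hup z hz j, hup x hx j, hmσ z hz j, hmσ x hx j]

/-- **Brouwer's fixed point theorem** for the standard simplex. -/
theorem exists_fixedPoint_stdSimplex [Nonempty ι] {f : (ι → ℝ) → ι → ℝ}
    (hf : ContinuousOn f (stdSimplex ℝ ι))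
    (hmaps : Set.MapsTo f (stdSimplex ℝ ι) (stdSimplex ℝ ι)) :
    ∃ x ∈ stdSimplex ℝ ι, f x = x := by
  classical
  -- `x` and `f x` have equal coordinate sums, so some coordinate does not decrease.
  have hcolor : ∀ x : ι → ℝ, ∃ i, x ∈ stdSimplex ℝ ι → x i ≤ f x i := by
    intro x
    by_cases hx : x ∈ stdSimplex ℝ ι
    · by_contra! h
      have := Finset.sum_lt_sum_of_nonempty Finset.univ_nonempty fun i _ => (h i).2
      rw [hx.2, (hmaps hx).2] at this
      exact this.false
    · obtain ⟨i⟩ := ‹Nonempty ι›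
      exact ⟨i, fun h => absurd h hx⟩
  choose c hc using hcolor
  have happrox : ∀ ε > 0, ∃ z ∈ stdSimplex ℝ ι, ∀ i, z i - f z i ≤ ε := by
    intro ε hε
    obtain ⟨δ, hδ, hδf⟩ := Metric.uniformContinuousOn_iff.1
      ((isCompact_stdSimplex ℝ ι).uniformContinuousOn_of_continuous hf) (ε / 2) (half_pos hε)
    obtain ⟨z, hz, h⟩ := exists_near_colorful c (lt_min (half_pos hδ) (half_pos hε))
    refine ⟨z, hz, fun i => ?_⟩
    rcases h i with h | ⟨x, hx, rfl, hxz⟩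
    · linarith [(hmaps hz).1 i, h.trans (min_le_right _ _)]
    · have h1 := (dist_le_pi_dist x z (c x)).trans (hxz.trans (min_le_right _ _))
      have h2 := (dist_le_pi_dist (f x) (f z) (c x)).trans_lt
        (hδf x hx z hz ((hxz.trans (min_le_left _ _)).trans_lt (half_lt_self hδ)))
      rw [Real.dist_eq] at h1 h2
      linarith [(abs_le.1 h1).1, (abs_lt.1 h2).2, hc x hx]
  have hcont : ContinuousOn (fun x => ∑ i, max (x i - f x i) 0) (stdSimplex ℝ ι) := by
    fun_prop
  obtain ⟨z, hz, hmin⟩ := (isCompact_stdSimplex ℝ ι).exists_isMinOn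
    ⟨_, single_mem_stdSimplex ℝ (Classical.arbitrary ι)⟩ hcont
  have hzero : ∑ i, max (z i - f z i) 0 ≤ 0 := by
    refine le_of_forall_pos_le_add fun ε hε => ?_
    have hn0 : (0 : ℝ) < Fintype.card ι := by exact_mod_cast Fintype.card_pos
    obtain ⟨w, hw, h⟩ := happrox (ε / Fintype.card ι) (by positivity)
    refine (hmin hw).trans ((Finset.sum_le_card_nsmul _ _ (ε / Fintype.card ι)
      fun i _ => max_le (h i) (by positivity)).trans ?_)
    rw [Finset.card_univ, nsmul_eq_mul, mul_div_cancel₀ _ hn0.ne', zero_add]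
  have hle : ∀ i, z i ≤ f z i := by
    intro i
    have := (Finset.single_le_sum (f := fun i => max (z i - f z i) 0)
      (fun j _ => le_max_right _ _) (Finset.mem_univ i)).trans hzero
    exact sub_nonpos.1 ((le_max_left _ _).trans this)
  refine ⟨z, hz, funext fun i => ?_⟩
  have := (Finset.sum_eq_sum_iff_of_le fun i _ => hle i).1 (by rw [hz.2, (hmaps hz).2])
  exact (this i (Finset.mem_univ i)).symm

end Brouwer

/-! ### The fixed point of the relation -/

theorem theorem1 {E : Type*} [AddCommGroup E] [Module ℝ E] [TopologicalSpace E]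
    [IsTopologicalAddGroup E] [ContinuousSMul ℝ E] [T2Space E] [LocallyConvexSpace ℝ E]
    (X : Set E) (hXne : X.Nonempty) (hXconv : Convex ℝ X) (hXcomp : IsCompact X)
    (C : Set (E × E)) (hC : C ⊆ X ×ˢ X)
    (hlower : ∀ y ∈ X, IsOpenIn X (lowerSection X C y))
    (hupper : ∀ x ∈ X, Convex ℝ (upperSection X C x) ∧ (upperSection X C x).Nonempty) :
    ∃ x ∈ X, (x, x) ∈ C := by
  classical
  have : CompactSpace X := isCompact_iff_compactSpace.1 hXcomp
  let U : X → Set X := fun y => {x | (x.1, y.1) ∈ C}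
  have hUo : ∀ y, IsOpen (U y) := fun y => by
    have h := hlower y y.2
    rw [IsOpenIn] at h
    convert h using 1
    ext x
    simp [U, lowerSection]
  have hUcov : (Set.univ : Set X) ⊆ ⋃ y, U y := fun x _ => by
    obtain ⟨y, hy, hxy⟩ := (hupper x x.2).2
    exact Set.mem_iUnion.2 ⟨⟨y, hy⟩, hxy⟩
  obtain ⟨s, hs⟩ := isCompact_univ.elim_finite_subcover U hUo hUcov
  obtain ⟨g, hg⟩ := PartitionOfUnity.exists_isSubordinate isClosed_univ
    (fun y : s => U y) (fun y => hUo y) (by simpa [Set.iUnion_subtype] using hs)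
  have hgsum : ∀ x, ∑ y, g y x = 1 := fun x => by
    rw [← finsum_eq_sum_of_fintype]
    exact g.sum_eq_one (Set.mem_univ x)
  have hgΔ : ∀ x, (fun y => g y x) ∈ stdSimplex ℝ s := fun x => ⟨fun y => g.nonneg y x, hgsum x⟩
  have : Nonempty s := by
    obtain ⟨x, hx⟩ := hXne
    by_contra hempty
    rw [not_nonempty_iff] at hempty
    simpa using hgsum ⟨x, hx⟩
  have hcomb : ∀ t ∈ stdSimplex ℝ s, ∑ y, t y • (y.1 : E) ∈ X := fun t ht =>
    hXconv.sum_mem (fun y _ => ht.1 y) ht.2 fun y _ => y.1.2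
  let φ : stdSimplex ℝ s → X := fun t => ⟨∑ y, t.1 y • (y.1 : E), hcomb t t.2⟩
  have hφ : Continuous φ := by
    refine Continuous.subtype_mk (continuous_finsetSum _ fun y _ => ?_) _
    exact ((continuous_apply y).comp continuous_subtype_val).smul continuous_const
  let f : (s → ℝ) → s → ℝ := fun t y => if ht : t ∈ stdSimplex ℝ s then g y (φ ⟨t, ht⟩) else 0
  have hfφ : ∀ t : stdSimplex ℝ s, f t.1 = fun y => g y (φ t) := fun t => by
    funext y
    simp only [f, dif_pos t.2]
  obtain ⟨t, ht, hfix⟩ := exists_fixedPoint_stdSimplex (f := f)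
    (by
      rw [continuousOn_iff_continuous_domRestrict]
      have : (stdSimplex ℝ s).domRestrict f = fun t y => g y (φ t) := funext hfφ
      rw [this]
      exact continuous_pi fun y => (g y).continuous.comp hφ)
    (fun t ht => hfφ ⟨t, ht⟩ ▸ hgΔ _)
  replace hfix := (hfφ ⟨t, ht⟩).symm.trans hfix
  set x := φ ⟨t, ht⟩ with hx
  have hmem : ∑ y, t y • (y.1 : E) ∈ upperSection X C x := by
    rw [← finsum_eq_sum_of_fintype]
    refine (hupper x x.2).1.finsum_mem ht.1 (by rw [finsum_eq_sum_of_fintype, ht.2]) ?_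
    intro y hy
    refine ⟨y.1.2, hg y (subset_tsupport _ ?_)⟩
    rw [Function.mem_support]
    rwa [← congrFun hfix y] at hy
  exact ⟨x, x.2, hmem.2⟩
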